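/- Let $P$ be a subsemigroup of a group (an identity element in $P$ is not required). For $p\in P$ let $V_p$ be the isometry of $\ell^2P$ with $V_p\delta_x=\delta_{px}$, and let $C^*_\lambda(P)\subseteq\mathcal L(\ell^2P)$ be the C*-algebra generated by $\{V_p : p\in P\}$, i.e. the smallest norm-closed, adjoint-invariant subalgebra containing all $V_p$. Let $I_l(P)$ be the left inverse hull of $P$: the smallest semigroup of partial bijections of $P$ (under composition) which is closed under inverses and contains all the maps $P\to pP,\ x\mapsto px$ $(p\in P)$; the latter map is again denoted by $p$. Let $I_l(P)^\times$ be the set of all elements of $I_l(P)$ different from the nowhere defined partial bijection. For $s\in I_l(P)$ let $\lambda_s$ be the partial isometry of $\ell^2 I_l(P)^\times$ with $\lambda_s\delta_x=\delta_{sx}$ if $s^{-1}s\ge xx^{-1}$ and $\lambda_s\delta_x=0$ otherwise, where for idempotents $e\le f$ means $e=ef$. Let $C^*_\lambda(I_l(P))\subseteq\mathcal L(\ell^2I_l(P)^\times)$ be the C*-algebra generated by $\{\lambda_s : s\in I_l(P)\}$. Let $\mathcal J_P$ be the set of constructible right ideals of $P$, i.e. the semilattice of idempotents of $I_l(P)$,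 each idempotent being identified with its domain; thus $\mathcal J_P=\{\mathrm{dom}(s) : s\in I_l(P)\}$. We say that $P$ satisfies independence if, whenever $n\ge1$ and $X,X_1,\dots,X_n\in\mathcal J_P$ satisfy $X=\bigcup_{i=1}^nX_i$, then $X=X_i$ for some $1\le i\le n$. **Proposition.** There is a unique *-homomorphism $C^*_\lambda(I_l(P))\to C^*_\lambda(P)$ with $\lambda_p\mapsto V_p$ for all $p\in P$, and it is an isomorphism if and only if $P$ satisfies independence. -/

import Mathlib

open scoped ENNReal lp

noncomputable section

namespace SemigroupCStar

/-! ### Operators on `ℓ²` given by partial bijections -/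

/-- The Hilbert space `ℓ² X` with orthonormal basis `δ x`, `x : X`. -/
abbrev EllTwo (X : Type*) : Type _ := ℓ²(X, ℂ)

/-- The canonical basis vector `δ_x`. -/
def delta {X : Type*} (x : X) : EllTwo X :=
  letI := Classical.decEq X
  lp.single 2 x (1 : ℂ)

/-- The coordinates of the image of `ξ` under the partial bijection `f`: the coordinate at `y`
is `ξ x` if `y = f x`, and `0` if `y` is not in the image of `f`. -/
def pushFun {X : Type*} (f : X ≃. X) (ξ : X → ℂ) (y : X) : ℂ := (f.symm y).elim 0 ξ

theorem pushFun_sum_le {X : Type*} (f : X ≃. X) (ξ : EllTwo X) (F : Finset X) :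
    ∑ y ∈ F, ‖pushFun f ξ y‖ ^ (2 : ℝ≥0∞).toReal ≤ ‖ξ‖ ^ (2 : ℝ≥0∞).toReal := by
  classical
  have hinj : ∀ a a' b, b ∈ f.symm a → b ∈ f.symm a' → a = a' :=
    fun a a' b h h' => PEquiv.inj f.symm h h'
  have h1 : ∑ y ∈ F, ‖pushFun f ξ y‖ ^ (2 : ℝ≥0∞).toReal
      = ∑ x ∈ F.filterMap f.symm hinj, ‖ξ x‖ ^ (2 : ℝ≥0∞).toReal := by
    symm
    refine Finset.sum_of_injOn (fun x => (f x).getD x) ?_ ?_ ?_ ?_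
    · intro a ha b hb hab
      simp only [Finset.mem_coe, Finset.mem_filterMap, PEquiv.eq_some_iff] at ha hb
      obtain ⟨u, -, hu⟩ := ha
      obtain ⟨v, -, hv⟩ := hb
      simp only [hu, hv, Option.getD_some] at hab
      subst hab
      exact PEquiv.inj f hu hv
    · intro a ha
      simp only [Finset.mem_coe, Finset.mem_filterMap, PEquiv.eq_some_iff] at ha
      obtain ⟨u, hF, hu⟩ := ha
      simpa [hu] using hF
    · intro y hy hn
      have : f.symm y = none := by
        by_contra hne
        obtain ⟨x, hx⟩ := Option.ne_none_iff_exists'.1 hne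
        refine hn ⟨x, ?_, ?_⟩
        · simp only [Finset.mem_coe, Finset.mem_filterMap]
          exact ⟨y, hy, hx⟩
        · simp [(PEquiv.eq_some_iff f).1 hx]
      simp [pushFun, this]
    · intro a ha
      simp only [Finset.mem_filterMap, PEquiv.eq_some_iff] at ha
      obtain ⟨u, -, hu⟩ := ha
      simp [pushFun, hu, (PEquiv.eq_some_iff f).2 hu]
  rw [h1]
  exact lp.sum_rpow_le_norm_rpow (by norm_num) ξ _

/-- The partial isometry on `ℓ² X` given by a partial bijection `f` of `X`: it sends `δ x` to
`δ (f x)` if `x` is in the domain of `f`, and to `0` otherwise. -/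
def partialIsometry {X : Type*} (f : X ≃. X) : EllTwo X →L[ℂ] EllTwo X :=
  LinearMap.mkContinuous
    { toFun := fun ξ => ⟨pushFun f ξ, memℓp_gen' (pushFun_sum_le f ξ)⟩
      map_add' := by
        intro ξ η
        ext y
        simp only [pushFun, lp.coeFn_add, Pi.add_apply]
        cases f.symm y <;> simp
      map_smul' := by
        intro c ξ
        ext y
        simp only [pushFun, lp.coeFn_smul, Pi.smul_apply, RingHom.id_apply]
        cases f.symm y <;> simp }
    1
    (fun ξ => by
      rw [one_mul]
      exact lp.norm_le_of_forall_sum_le (by norm_num) (norm_nonneg _) (pushFun_sum_le f ξ))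

theorem partialIsometry_delta {X : Type*} (f : X ≃. X) (x : X) :
    partialIsometry f (delta x) = (f x).elim 0 delta := by
  classical
  ext y
  change (f.symm y).elim 0 (delta x) = _
  have hd : ∀ u v : X, (delta u : EllTwo X) v = if v = u then 1 else 0 := by
    intro u v
    unfold delta
    split_ifs with h
    · subst h; simp
    · rw [lp.single_apply_ne _ _ _ h]
  rcases h : f.symm y with _ | z
  · rcases h' : f x with _ | w
    · simp
    · have : y ≠ w := by
        rintro rfl
        rw [(PEquiv.eq_some_iff f).2 h'] at h
        cases h
      simp [hd, this]
  · have hz := (PEquiv.eq_some_iff f).1 h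
    rcases h' : f x with _ | w
    · have : z ≠ x := by
        rintro rfl
        rw [hz] at h'
        cases h'
      simp [hd, this]
    · have : z = x ↔ y = w := by
        constructor
        · rintro rfl
          rw [hz] at h'
          exact Option.some.inj h'
        · rintro rfl
          exact PEquiv.inj f hz h'
      simp [hd, this]

/-- The C*-algebra generated by a set `A` of bounded operators on a Hilbert space: the smallest
norm-closed subalgebra that contains `A` and is invariant under forming adjoints. -/
abbrev generatedCStar {X : Type*} (A : Set (EllTwo X →L[ℂ] EllTwo X)) :
    NonUnitalStarSubalgebra ℂ (EllTwo X →L[ℂ] EllTwo X) :=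
  (NonUnitalStarAlgebra.adjoin ℂ A).topologicalClosure

theorem subset_generatedCStar {X : Type*} (A : Set (EllTwo X →L[ℂ] EllTwo X)) :
    A ⊆ generatedCStar A :=
  fun _ ha => NonUnitalStarSubalgebra.le_topologicalClosure _
    (NonUnitalStarAlgebra.subset_adjoin ℂ A ha)

variable (P : Type*) [Semigroup P] [IsLeftCancelMul P]

/-! ### The reduced semigroup C*-algebra -/

variable {P} in
/-- The partial bijection `P → pP`, `x ↦ p x`, with domain `P`. -/
def leftMul (p : P) : P ≃. P where
  toFun x := some (p * x)
  invFun := Function.partialInv (fun x => p * x)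
  inv x y := by
    rw [Function.Injective.isPartialInv (mul_right_injective p) x y, Option.some_inj]

variable {P} in
/-- The isometry `V_p` on `ℓ² P`, `δ_x ↦ δ_{p x}`. -/
def isometryV (p : P) : EllTwo P →L[ℂ] EllTwo P := partialIsometry (leftMul p)

/-- `C*_λ(P)`, the C*-algebra generated by the isometries `V_p`, `p ∈ P`. -/
def reducedSemigroupCStar : NonUnitalStarSubalgebra ℂ (EllTwo P →L[ℂ] EllTwo P) :=
  generatedCStar (Set.range (isometryV (P := P)))

variable {P} in
/-- `V_p` as an element of `C*_λ(P)`. -/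
def genV (p : P) : reducedSemigroupCStar P :=
  ⟨isometryV p, subset_generatedCStar _ (Set.mem_range_self p)⟩

/-! ### The left inverse hull -/

/-- Membership in the smallest semigroup of partial bijections of `P` that is closed under
inverses and contains all left multiplications. The composite `s ∘ t` is `t.trans s`. -/
inductive MemHull : (P ≃. P) → Prop
  | leftMul (p : P) : MemHull (leftMul p)
  | symm (s : P ≃. P) : MemHull s → MemHull s.symm
  | comp (s t : P ≃. P) : MemHull s → MemHull t → MemHull (t.trans s)

/-- The left inverse hull `I_l(P)`. -/
def LeftInverseHull : Type _ := {s : P ≃. P // MemHull P s}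

namespace LeftInverseHull

variable {P}

/-- Multiplication is composition of partial bijections, `(s * t)(x) = s (t x)`. -/
instance : Semigroup (LeftInverseHull P) where
  mul s t := ⟨t.1.trans s.1, .comp s.1 t.1 s.2 t.2⟩
  mul_assoc s t u := Subtype.ext (PEquiv.trans_assoc u.1 t.1 s.1).symm

instance : Inv (LeftInverseHull P) where
  inv s := ⟨s.1.symm, .symm s.1 s.2⟩

/-- The domain of a partial bijection. -/
def dom (s : LeftInverseHull P) : Set P := {x | (s.1 x).isSome}

/-- The canonical map `P → I_l(P)`. -/
def ofElem (p : P) : LeftInverseHull P := ⟨leftMul p, .leftMul p⟩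

/-- The relation `x x⁻¹ ≤ s⁻¹ s` in the semilattice of idempotents, where `e ≤ f` means
`e = e f`. -/
def RangeLEDom (s x : LeftInverseHull P) : Prop :=
  x * x⁻¹ = (x * x⁻¹) * (s⁻¹ * s)

theorem mul_inv_mul (s : LeftInverseHull P) : s * s⁻¹ * s = s := by
  apply Subtype.ext
  change s.1.trans (s.1.symm.trans s.1) = s.1
  refine PEquiv.ext fun x => Option.ext fun y => ?_
  simp only [PEquiv.trans_eq_some]
  constructor
  · rintro ⟨a, ha, b, hb, hy⟩
    have : b = x := PEquiv.inj s.1 ((PEquiv.mem_iff_mem _).1 hb) ha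
    exact this ▸ hy
  · intro hy
    exact ⟨y, hy, x, (PEquiv.mem_iff_mem _).2 hy, hy⟩

theorem mul_inv_rev (s t : LeftInverseHull P) : (s * t)⁻¹ = t⁻¹ * s⁻¹ := rfl

theorem inv_inv (s : LeftInverseHull P) : s⁻¹⁻¹ = s := rfl

theorem rangeLEDom_iff (s x : LeftInverseHull P) : RangeLEDom s x ↔ s⁻¹ * (s * x) = x := by
  have h0 : RangeLEDom s x ↔ x * x⁻¹ = (s⁻¹ * s) * (x * x⁻¹) := by
    unfold RangeLEDom
    constructor
    · intro h
      have := congrArg (fun z => z⁻¹) h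
      simpa only [mul_inv_rev, inv_inv] using this
    · intro h
      have := congrArg (fun z => z⁻¹) h
      simpa only [mul_inv_rev, inv_inv] using this
  rw [h0]
  constructor
  · intro h
    have := congrArg (fun z => z * x) h
    simp only [mul_inv_mul] at this
    rw [mul_assoc (s⁻¹ * s), mul_inv_mul, mul_assoc] at this
    exact this.symm
  · intro h
    rw [← mul_assoc (s⁻¹ * s), mul_assoc s⁻¹ s x, h]

variable (P) in
/-- `I_l(P)^×`: the elements of the left inverse hull other than the nowhere defined partial
bijection (if the latter belongs to `I_l(P)`, it is the distinguished zero). -/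
def Nonzero : Type _ := {s : LeftInverseHull P // s.1 ≠ ⊥}

theorem mul_ne_bot {s x : LeftInverseHull P} (hx : x.1 ≠ ⊥) (h : RangeLEDom s x) :
    (s * x).1 ≠ ⊥ := by
  intro h0
  apply hx
  have h1 := congrArg Subtype.val ((rangeLEDom_iff s x).1 h)
  rw [← h1]
  change (s * x).1.trans s.1.symm = ⊥
  rw [h0, PEquiv.bot_trans]

theorem rangeLEDom_inv {s x : LeftInverseHull P} (h : RangeLEDom s x) :
    RangeLEDom s⁻¹ (s * x) := by
  rw [rangeLEDom_iff] at h ⊢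
  rw [h, inv_inv]

open Classical in
/-- The partial bijection `x ↦ s x` of `I_l(P)^×`, defined for those `x` with
`s⁻¹ s ≥ x x⁻¹`. -/
def act (s : LeftInverseHull P) : Nonzero P ≃. Nonzero P where
  toFun x := if h : RangeLEDom s x.1 then some ⟨s * x.1, mul_ne_bot x.2 h⟩ else none
  invFun y := if h : RangeLEDom s⁻¹ y.1 then some ⟨s⁻¹ * y.1, mul_ne_bot y.2 h⟩ else none
  inv x y := by
    constructor
    · intro h
      split_ifs at h with hy
      have hx := Option.some.inj h
      subst hx
      have h2 := rangeLEDom_inv hy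
      have h3 := (rangeLEDom_iff _ _).1 hy
      rw [inv_inv] at h2 h3
      rw [dif_pos h2]
      exact congrArg some (Subtype.ext h3)
    · intro h
      split_ifs at h with hx
      have hy := Option.some.inj h
      subst hy
      rw [dif_pos (rangeLEDom_inv hx)]
      exact congrArg some (Subtype.ext ((rangeLEDom_iff _ _).1 hx))

/-- The partial isometry `λ_s` on `ℓ² I_l(P)^×`: `δ_x ↦ δ_{s x}` if `s⁻¹ s ≥ x x⁻¹`, and
`δ_x ↦ 0` otherwise. -/
def lambda (s : LeftInverseHull P) : EllTwo (Nonzero P) →L[ℂ] EllTwo (Nonzero P) :=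
  partialIsometry (act s)

end LeftInverseHull

open LeftInverseHull

/-- `C*_λ(I_l(P))`, the C*-algebra generated by the partial isometries `λ_s`, `s ∈ I_l(P)`. -/
def reducedHullCStar :
    NonUnitalStarSubalgebra ℂ (EllTwo (Nonzero P) →L[ℂ] EllTwo (Nonzero P)) :=
  generatedCStar (Set.range (lambda (P := P)))

variable {P} in
/-- `λ_p`, for `p ∈ P ⊆ I_l(P)`, as an element of `C*_λ(I_l(P))`. -/
def genLambda (p : P) : reducedHullCStar P :=
  ⟨lambda (ofElem p), subset_generatedCStar _ (Set.mem_range_self _)⟩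

/-! ### Independence -/

/-- `𝒥_P`, the constructible right ideals of `P`: the semilattice of idempotents of `I_l(P)`,
each idempotent `s⁻¹ s` being identified with the subset of `P` on which it is the identity,
i.e. with the domain of `s`. -/
def constructibleIdeals : Set (Set P) := Set.range (dom (P := P))

/-- The independence condition: a constructible right ideal that is the union of finitely many
(at least one) constructible right ideals is equal to one of them. -/
def Independence : Prop :=
  ∀ X ∈ constructibleIdeals P, ∀ (n : ℕ) (Y : Fin (n + 1) → Set P),
    (∀ i, Y i ∈ constructibleIdeals P) → X = ⋃ i, Y i → ∃ i, X = Y i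

end SemigroupCStar

end

/-! Write `opV s` for the partial isometry of `ℓ² P` given by `s ∈ I_l(P)`. Both `lambda` and `opV`
are multiplicative and turn inverses into adjoints, so the spans of their ranges are dense
*-subalgebras. A *-homomorphism with `λ_p ↦ V_p` must send every `λ_s` to `opV s`, which gives
uniqueness. Existence amounts to the inequality `‖∑ c_s V_s‖ ≤ ‖∑ c_s λ_s‖` for finite sums, and the
reverse inequality makes the homomorphism bijective.

Both inequalities come from `norm_sum_partialIsometry_le`: it suffices to copy finite pieces of one
action injectively into the other. From `P` to `I_l(P)^×`, fix `p` in a finite piece `S` of an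
orbit, choose `t_x` with `t_x p = x`, and send `x` to `t_x ε`, where `ε` is an idempotent whose
domain is a small enough constructible ideal around `p`. From `I_l(P)^×` to `P`, take finitely many
elements with common domain `X` and send each one to its value at a point `p ∈ X` avoiding finitely
many constructible ideals properly contained in `X`; independence supplies `p`. The ambient group
enters through `ext_of_dom_eq`: an element of `I_l(P)` is determined by its domain and one value.

Conversely, if `X = ⋃ X_i` with all `X_i ≠ X`, then with `e`, `f_i` the idempotents of `X`, `X_i`,
the product `λ_e ∏ (1 - λ_{f_i})` fixes `δ_e` but is sent to `0` (`independence_of_injective`). -/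

noncomputable section

namespace SemigroupCStar

/-! ### Finitely supported vectors in `ℓ²` and norm comparison for actions by partial bijections -/

section EllTwo

variable {X Y I O : Type*}

theorem delta_apply_self (u : X) : (delta u : EllTwo X) u = 1 :=
  letI := Classical.decEq X
  lp.single_apply_self 2 u 1

theorem delta_apply_ne {u v : X} (h : v ≠ u) : (delta u : EllTwo X) v = 0 :=
  letI := Classical.decEq X
  lp.single_apply_ne 2 u 1 h

theorem delta_apply [DecidableEq X] (u v : X) :
    (delta u : EllTwo X) v = if v = u then 1 else 0 := by
  split_ifs with h
  · subst h; exact delta_apply_self v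
  · exact delta_apply_ne h

theorem inner_delta_left (x : X) (ξ : EllTwo X) : inner ℂ (delta x) ξ = ξ x := by
  classical
  have := lp.inner_single_left (𝕜 := ℂ) (G := fun _ : X => ℂ) x 1 ξ
  simpa [delta] using this

theorem inner_delta_right (x : X) (ξ : EllTwo X) : inner ℂ ξ (delta x) = star (ξ x) := by
  rw [← inner_conj_symm, inner_delta_left]
  rfl

theorem delta_ne_zero (x : X) : (delta x : EllTwo X) ≠ 0 := by
  classical
  intro h
  have := congrArg (fun ξ : EllTwo X => ξ x) h
  simp [delta_apply] at this

/-- The vector of `ℓ² X` given by a finitely supported function. -/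
def finsuppVec : (X →₀ ℂ) →ₗ[ℂ] EllTwo X := Finsupp.linearCombination ℂ delta

theorem finsuppVec_single (x : X) (c : ℂ) : finsuppVec (Finsupp.single x c) = c • delta x := by
  simp [finsuppVec]

theorem finsuppVec_apply (f : X →₀ ℂ) (x : X) : (finsuppVec f : EllTwo X) x = f x := by
  classical
  induction f using Finsupp.induction_linear with
  | zero => simp
  | add f g hf hg => simp [map_add, hf, hg]
  | single y c =>
    rw [finsuppVec_single, lp.coeFn_smul, Pi.smul_apply, delta_apply, Finsupp.single_apply]
    simp [eq_comm]

theorem norm_finsuppVec_sq (f : X →₀ ℂ) :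
    ‖(finsuppVec f : EllTwo X)‖ ^ 2 = f.sum fun _ c => ‖c‖ ^ 2 := by
  have h := lp.norm_rpow_eq_tsum (p := 2) (by norm_num) (finsuppVec f : EllTwo X)
  simp only [ENNReal.toReal_ofNat, Real.rpow_ofNat] at h
  rw [h, tsum_eq_sum (s := f.support)]
  · simp only [finsuppVec_apply]; rfl
  · intro x hx
    simp [finsuppVec_apply, Finsupp.notMem_support_iff.1 hx]

theorem dense_range_finsuppVec : DenseRange (finsuppVec : (X →₀ ℂ) → EllTwo X) := by
  classical
  intro ξ
  have h := lp.hasSum_single (p := 2) (by norm_num) ξ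
  refine mem_closure_of_tendsto h (Filter.Eventually.of_forall fun s => ?_)
  refine ⟨∑ x ∈ s, Finsupp.single x (ξ x), ?_⟩
  rw [map_sum]
  refine Finset.sum_congr rfl fun x _ => ?_
  rw [finsuppVec_single]
  ext y
  rw [lp.coeFn_smul, Pi.smul_apply, delta_apply]
  by_cases hy : y = x
  · subst hy; simp
  · simp [hy]

theorem clm_ext_delta {A B : EllTwo X →L[ℂ] EllTwo Y} (h : ∀ x, A (delta x) = B (delta x)) :
    A = B := by
  have : (A : EllTwo X → EllTwo Y) = B := by
    refine dense_range_finsuppVec.equalizer A.continuous B.continuous (funext fun f => ?_)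
    induction f using Finsupp.induction_linear with
    | zero => simp
    | add f g hf hg => simpa [map_add] using congrArg₂ (· + ·) hf hg
    | single y c => simp [finsuppVec_single, h]
  exact DFunLike.coe_injective this

theorem partialIsometry_trans (f g : X ≃. X) :
    partialIsometry (g.trans f) = partialIsometry f * partialIsometry g := by
  refine clm_ext_delta fun x => ?_
  rw [mul_apply_eq_comp, partialIsometry_delta, partialIsometry_delta]
  have : (g.trans f) x = (g x).bind f := rfl
  rw [this]
  rcases g x with _ | y
  · simp
  · simp [partialIsometry_delta]

theorem star_partialIsometry (f : X ≃. X) :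
    star (partialIsometry f) = partialIsometry f.symm := by
  classical
  refine clm_ext_delta fun y => ?_
  ext x
  rw [← inner_delta_left, ContinuousLinearMap.star_eq_adjoint,
    ContinuousLinearMap.adjoint_inner_right, partialIsometry_delta, partialIsometry_delta,
    inner_delta_right]
  rcases hx : f x with _ | z <;> rcases hy : f.symm y with _ | w
  · simp
  · have : w ≠ x := by
      rintro rfl
      rw [PEquiv.eq_some_iff, hx] at hy
      cases hy
    simp [delta_apply, this.symm]
  · have : y ≠ z := by
      rintro rfl
      rw [← PEquiv.eq_some_iff, hy] at hx
      cases hx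
    simp [delta_apply, this]
  · have : y = z ↔ x = w := by
      rw [PEquiv.eq_some_iff] at hy
      constructor
      · rintro rfl
        exact PEquiv.inj f hx hy
      · rintro rfl
        rw [hx] at hy
        exact (Option.some.inj hy).symm
    simp [delta_apply, this]

/-- A partial bijection acting on finitely supported functions. -/
def finsuppAct (f : X ≃. X) : (X →₀ ℂ) →ₗ[ℂ] (X →₀ ℂ) :=
  Finsupp.linearCombination ℂ fun x => (f x).elim 0 fun y => Finsupp.single y 1

theorem finsuppAct_single (f : X ≃. X) (x : X) (c : ℂ) :
    finsuppAct f (Finsupp.single x c) = (f x).elim 0 fun y => Finsupp.single y c := by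
  rcases h : f x <;> simp [finsuppAct, h]

theorem partialIsometry_finsuppVec (f : X ≃. X) (ξ : X →₀ ℂ) :
    partialIsometry f (finsuppVec ξ) = finsuppVec (finsuppAct f ξ) := by
  induction ξ using Finsupp.induction_linear with
  | zero => simp
  | add f g hf hg => simp only [map_add, hf, hg]
  | single x c =>
    rw [finsuppVec_single, map_smul, partialIsometry_delta, finsuppAct_single]
    rcases f x with _ | y <;> simp [finsuppVec_single]

theorem norm_finsuppVec_mapDomain (θ : X → Y) (f : X →₀ ℂ) (S : Finset X) (hS : f.support ⊆ S)
    (hθ : Set.InjOn θ S) :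
    ‖(finsuppVec (f.mapDomain θ) : EllTwo Y)‖ = ‖(finsuppVec f : EllTwo X)‖ := by
  classical
  refine (sq_eq_sq₀ (norm_nonneg _) (norm_nonneg _)).1 ?_
  have hinj : Set.InjOn θ f.support := hθ.mono (by exact_mod_cast hS)
  rw [norm_finsuppVec_sq, norm_finsuppVec_sq, Finsupp.sum, Finsupp.sum,
    Finsupp.mapDomain_support_of_injOn f hinj, Finset.sum_image hinj]
  refine Finset.sum_congr rfl fun x hx => ?_
  rw [Finsupp.mapDomain_apply' (f.support : Set X) f subset_rfl hinj hx]

/-- Pythagoras: the restrictions of `f` to distinct label classes have disjoint supports. -/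
theorem norm_finsuppVec_sq_eq_sum_filter [DecidableEq O] (o : X → O) (f : X →₀ ℂ) (L : Finset O)
    (hL : ∀ x ∈ f.support, o x ∈ L) :
    ‖(finsuppVec f : EllTwo X)‖ ^ 2
      = ∑ l ∈ L, ‖(finsuppVec (f.filter fun x => o x = l) : EllTwo X)‖ ^ 2 := by
  classical
  simp only [norm_finsuppVec_sq, Finsupp.sum, Finsupp.support_filter]
  rw [← Finset.sum_fiberwise_of_maps_to hL]
  refine Finset.sum_congr rfl fun l _ => Finset.sum_congr rfl fun x hx => ?_
  rw [Finsupp.filter_apply_pos (fun x => o x = l) _ (Finset.mem_filter.1 hx).2]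

theorem finsuppAct_filter (a : X ≃. X) (o : X → O) (ho : ∀ x y, a x = some y → o y = o x)
    (l : O) [DecidablePred fun x => o x = l] (f : X →₀ ℂ) :
    finsuppAct a (f.filter fun x => o x = l) = (finsuppAct a f).filter fun x => o x = l := by
  induction f using Finsupp.induction_linear with
  | zero => simp [Finsupp.filter_zero]
  | add f g hf hg => simp only [map_add, Finsupp.filter_add, hf, hg]
  | single x c =>
    rw [finsuppAct_single]
    rcases h : a x with _ | y
    · by_cases hx : o x = l
      · rw [Finsupp.filter_single_of_pos (fun x => o x = l) hx, finsuppAct_single, h]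
        simp [Finsupp.filter_zero]
      · rw [Finsupp.filter_single_of_neg (fun x => o x = l) hx]; simp [Finsupp.filter_zero]
    · by_cases hx : o x = l
      · rw [Finsupp.filter_single_of_pos (fun x => o x = l) hx, finsuppAct_single, h,
          Option.elim_some, Finsupp.filter_single_of_pos (fun x => o x = l) ((ho x y h).trans hx)]
      · rw [Finsupp.filter_single_of_neg (fun x => o x = l) hx, Option.elim_some,
          Finsupp.filter_single_of_neg (fun x => o x = l) (by rw [ho x y h]; exact hx), map_zero]

/-- `θ` intertwines the partial bijections `a` and `b` on the finite set `S`. -/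
def Intertwines (a : X ≃. X) (b : Y ≃. Y) (θ : X → Y) (S : Finset X) : Prop :=
  ∀ x ∈ S, (∀ y ∈ S, a x = some y → b (θ x) = some (θ y)) ∧ (a x = none → b (θ x) = none)

theorem Intertwines.mapDomain {a : X ≃. X} {b : Y ≃. Y} {θ : X → Y} {S : Finset X}
    (h : Intertwines a b θ S) (f : X →₀ ℂ)
    (hf : ∀ x ∈ f.support, x ∈ S ∧ ∀ y, a x = some y → y ∈ S) :
    finsuppAct b (f.mapDomain θ) = (finsuppAct a f).mapDomain θ := by
  classical
  have hs := f.sum_single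
  rw [← hs, Finsupp.sum, Finsupp.mapDomain_finsetSum, map_sum, map_sum, Finsupp.mapDomain_finsetSum]
  refine Finset.sum_congr rfl fun x hx => ?_
  obtain ⟨hxS, hy⟩ := hf x hx
  rw [Finsupp.mapDomain_single, finsuppAct_single, finsuppAct_single]
  rcases hax : a x with _ | y
  · rw [(h x hxS).2 hax]; simp
  · rw [(h x hxS).1 y (hy y hax) hax]; simp [Finsupp.mapDomain_single]

theorem norm_le_of_finsuppVec {A : EllTwo X →L[ℂ] EllTwo X} {C : ℝ} (hC : 0 ≤ C)
    (h : ∀ f : X →₀ ℂ, ‖A (finsuppVec f)‖ ≤ C * ‖(finsuppVec f : EllTwo X)‖) : ‖A‖ ≤ C := by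
  refine ContinuousLinearMap.opNorm_le_bound _ hC fun ξ => ?_
  have hcl : IsClosed {ξ : EllTwo X | ‖A ξ‖ ≤ C * ‖ξ‖} :=
    isClosed_le (by fun_prop) (by fun_prop)
  exact hcl.closure_subset_iff.2 (Set.range_subset_iff.2 h) (dense_range_finsuppVec ξ)

/-- If an action by partial bijections can locally, on each class of an invariant labelling, be
found inside another one, then it gives rise to smaller operator norms. -/
theorem norm_sum_partialIsometry_le (a : I → X ≃. X) (b : I → Y ≃. Y) (o : X → O)
    (ho : ∀ i x y, a i x = some y → o y = o x)
    (hloc : ∀ (T : Finset I) (S : Finset X), S.Nonempty → (∀ x ∈ S, ∀ y ∈ S, o x = o y) →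
      ∃ θ : X → Y, Set.InjOn θ S ∧ ∀ i ∈ T, Intertwines (a i) (b i) θ S)
    (T : Finset I) (c : I → ℂ) :
    ‖∑ i ∈ T, c i • partialIsometry (a i)‖ ≤ ‖∑ i ∈ T, c i • partialIsometry (b i)‖ := by
  classical
  set B := ∑ i ∈ T, c i • partialIsometry (b i) with hB
  let A' : (X →₀ ℂ) →ₗ[ℂ] (X →₀ ℂ) := ∑ i ∈ T, c i • finsuppAct (a i)
  have hA : ∀ f, (∑ i ∈ T, c i • partialIsometry (a i)) (finsuppVec f) = finsuppVec (A' f) := by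
    intro f
    simp [A', partialIsometry_finsuppVec, LinearMap.sum_apply]
  have hclass : ∀ (f : X →₀ ℂ), (∀ x ∈ f.support, ∀ y ∈ f.support, o x = o y) →
      ‖(finsuppVec (A' f) : EllTwo X)‖ ≤ ‖B‖ * ‖(finsuppVec f : EllTwo X)‖ := by
    intro f hf
    by_cases hf0 : f = 0
    · simp [hf0]
    -- `S` holds the support together with its images under the `a i`, so that `f` and `A' f` both
    -- live on `S`; it stays inside one label class because labels are invariant.
    let S : Finset X := f.support ∪ T.biUnion fun i => f.support.biUnion fun x => (a i x).toFinset
    have hmem : ∀ x, x ∈ S ↔ x ∈ f.support ∨ ∃ i ∈ T, ∃ z ∈ f.support, a i z = some x := by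
      intro x; simp [S, -Finsupp.mem_support_iff]
    have hlab : ∀ x ∈ S, ∃ z ∈ f.support, o x = o z := by
      intro x hx
      rcases (hmem x).1 hx with h | ⟨i, -, z, hz, h⟩
      · exact ⟨x, h, rfl⟩
      · exact ⟨z, hz, ho i z x h⟩
    obtain ⟨θ, hinj, hθ⟩ := hloc T S
      ((Finsupp.support_nonempty_iff.2 hf0).mono Finset.subset_union_left) (by
        intro x hx y hy
        obtain ⟨z, hz, h1⟩ := hlab x hx
        obtain ⟨w, hw, h2⟩ := hlab y hy
        rw [h1, h2, hf z hz w hw])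
    -- Transport along `θ` preserves norms on `S` and carries `A' f` to the value of `B` at the
    -- transported vector, so the operator norm of `B` bounds `A'` on this class.
    have hBθ : B (finsuppVec (f.mapDomain θ)) = finsuppVec ((A' f).mapDomain θ) := by
      have h1 : ∀ i ∈ T, partialIsometry (b i) (finsuppVec (f.mapDomain θ))
          = finsuppVec ((finsuppAct (a i) f).mapDomain θ) := by
        intro i hi
        rw [partialIsometry_finsuppVec, (hθ i hi).mapDomain f]
        intro x hx
        exact ⟨(hmem x).2 (.inl hx), fun y hy => (hmem y).2 (.inr ⟨i, hi, x, hx, hy⟩)⟩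
      simp only [hB, A', _root_.sum_apply, _root_.smul_apply,
        LinearMap.sum_apply, LinearMap.smul_apply, Finsupp.mapDomain_finsetSum, map_sum,
        Finsupp.mapDomain_smul, map_smul]
      exact Finset.sum_congr rfl fun i hi => by rw [h1 i hi]
    have hsupp : (A' f).support ⊆ S := by
      intro x hx
      by_contra hxS
      refine Finsupp.mem_support_iff.1 hx ?_
      simp only [A', LinearMap.sum_apply, LinearMap.smul_apply, Finsupp.finsetSum_apply,
        Finsupp.smul_apply]
      refine Finset.sum_eq_zero fun i hi => ?_
      rw [finsuppAct, Finsupp.linearCombination_apply, Finsupp.sum, Finsupp.finsetSum_apply,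
        Finset.sum_eq_zero, smul_zero]
      intro z hz
      rcases haz : a i z with _ | y
      · simp
      · have : y ≠ x := by
          rintro rfl
          exact hxS ((hmem y).2 (.inr ⟨i, hi, z, hz, haz⟩))
        simp [this]
    rw [← norm_finsuppVec_mapDomain θ (A' f) S hsupp hinj, ← hBθ,
      ← norm_finsuppVec_mapDomain θ f S Finset.subset_union_left hinj]
    exact B.le_opNorm _
  refine norm_le_of_finsuppVec (norm_nonneg _) fun f => ?_
  rw [hA]
  refine le_of_sq_le_sq ?_ (by positivity)
  -- Invariance of labels makes `A'` block diagonal, so the bound on single classes adds up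
  -- orthogonally.
  have hcomm : ∀ l, (A' f).filter (fun x => o x = l) = A' (f.filter fun x => o x = l) := by
    intro l
    simp only [A', LinearMap.sum_apply, LinearMap.smul_apply, Finsupp.filter_sum,
      Finsupp.filter_smul]
    exact Finset.sum_congr rfl fun i _ => by rw [finsuppAct_filter _ _ (ho i)]
  let L : Finset O := f.support.image o ∪ (A' f).support.image o
  rw [norm_finsuppVec_sq_eq_sum_filter o (A' f) L fun x hx =>
      Finset.mem_union_right _ (Finset.mem_image_of_mem _ hx), mul_pow,
    norm_finsuppVec_sq_eq_sum_filter o f L fun x hx =>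
      Finset.mem_union_left _ (Finset.mem_image_of_mem _ hx), Finset.mul_sum]
  refine Finset.sum_le_sum fun l _ => ?_
  rw [hcomm, ← mul_pow]
  refine pow_le_pow_left₀ (norm_nonneg _) (hclass _ fun x hx y hy => ?_) 2
  simp only [Finsupp.support_filter, Finset.mem_filter] at hx hy
  rw [hx.2, hy.2]

end EllTwo

/-! ### Homomorphisms of C*-algebras obtained from norm inequalities, by way of graphs -/

section Graph

variable {A B : Type*} [NonUnitalCStarAlgebra A] [NonUnitalCStarAlgebra B]

/-- The range of `w` is closed under products and adjoints, so its linear span is already a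
*-subalgebra. -/
theorem adjoin_range_le_span {I : Type*} [Mul I] [Inv I] (w : I → A)
    (hmul : ∀ s t, w (s * t) = w s * w t) (hinv : ∀ s, w s⁻¹ = star (w s)) {x : A}
    (hx : x ∈ NonUnitalStarAlgebra.adjoin ℂ (Set.range w)) :
    x ∈ Submodule.span ℂ (Set.range w) := by
  induction hx using NonUnitalStarAlgebra.adjoin_induction with
  | mem x hx => exact Submodule.subset_span hx
  | add x y _ _ hx hy => exact add_mem hx hy
  | zero => exact zero_mem _
  | smul r x _ hx => exact Submodule.smul_mem _ r hx
  | mul x y h1 h2 hx hy =>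
    clear h1 h2
    induction hx using Submodule.span_induction with
    | mem x hx =>
      obtain ⟨s, rfl⟩ := hx
      induction hy using Submodule.span_induction with
      | mem y hy =>
        obtain ⟨t, rfl⟩ := hy
        exact Submodule.subset_span ⟨s * t, hmul s t⟩
      | zero => simp
      | add y z _ _ hy hz => rw [mul_add]; exact add_mem hy hz
      | smul r y _ hy => rw [mul_smul_comm]; exact Submodule.smul_mem _ r hy
    | zero => simp
    | add y z _ _ hy hz => rw [add_mul]; exact add_mem hy hz
    | smul r y _ hy => rw [smul_mul_assoc]; exact Submodule.smul_mem _ r hy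
  | star x h1 hx =>
    clear h1
    induction hx using Submodule.span_induction with
    | mem x hx =>
      obtain ⟨s, rfl⟩ := hx
      exact Submodule.subset_span ⟨s⁻¹, hinv s⟩
    | zero => simp
    | add y z _ _ hy hz => rw [star_add]; exact add_mem hy hz
    | smul r y _ hy => rw [star_smul]; exact Submodule.smul_mem _ _ hy

/-- The closed subalgebra of `A × B` generated by the pairs `(u s, v s)`. -/
def jointCStar {I : Type*} (u : I → A) (v : I → B) : NonUnitalStarSubalgebra ℂ (A × B) :=
  (NonUnitalStarAlgebra.adjoin ℂ (Set.range fun s => (u s, v s))).topologicalClosure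

theorem mem_jointCStar {I : Type*} (u : I → A) (v : I → B) (s : I) :
    (u s, v s) ∈ jointCStar u v :=
  NonUnitalStarSubalgebra.le_topologicalClosure _
    (NonUnitalStarAlgebra.subset_adjoin ℂ _ (Set.mem_range_self s))

/-- The inequality is known on the span, which is dense, and both sides are continuous. It is
applied to the two projections of `A × B`. -/
theorem norm_map_le_of_mem_closure {C D I : Type*} [NonUnitalCStarAlgebra C]
    [NonUnitalCStarAlgebra D] [Mul I] [Inv I] (w : I → A)
    (hmul : ∀ s t, w (s * t) = w s * w t) (hinv : ∀ s, w s⁻¹ = star (w s))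
    (π : A →⋆ₙₐ[ℂ] C) (ρ : A →⋆ₙₐ[ℂ] D)
    (h : ∀ (T : Finset I) (c : I → ℂ), ‖∑ s ∈ T, c s • π (w s)‖ ≤ ‖∑ s ∈ T, c s • ρ (w s)‖)
    {x : A} (hx : x ∈ (NonUnitalStarAlgebra.adjoin ℂ (Set.range w)).topologicalClosure) :
    ‖π x‖ ≤ ‖ρ x‖ := by
  have hπ : Continuous π := by
    open scoped CStarAlgebra in exact ContinuousMapClass.map_continuous π
  have hρ : Continuous ρ := by
    open scoped CStarAlgebra in exact ContinuousMapClass.map_continuous ρ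
  have hcl : IsClosed {x : A | ‖π x‖ ≤ ‖ρ x‖} := isClosed_le hπ.norm hρ.norm
  refine hcl.closure_subset_iff.2 (fun y hy => ?_) hx
  obtain ⟨c, rfl⟩ := (Finsupp.mem_span_range_iff_exists_finsupp).1
    (adjoin_range_le_span w hmul hinv hy)
  simpa [Finsupp.sum, map_sum] using h c.support c

/-- A contraction that is bounded below on a complete space has complete, hence closed, image. -/
theorem closure_adjoin_image_le_map (π : A →⋆ₙₐ[ℂ] B) (s : Set A)
    (h : ∀ x ∈ (NonUnitalStarAlgebra.adjoin ℂ s).topologicalClosure, ‖x‖ ≤ ‖π x‖) :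
    (NonUnitalStarAlgebra.adjoin ℂ (π '' s)).topologicalClosure ≤
      (NonUnitalStarAlgebra.adjoin ℂ s).topologicalClosure.map π := by
  set D := (NonUnitalStarAlgebra.adjoin ℂ s).topologicalClosure with hD
  have hDc : IsClosed (D : Set A) := NonUnitalStarSubalgebra.isClosed_topologicalClosure _
  have hπ : UniformContinuous π :=
    (LipschitzWith.of_dist_le_mul (K := 1) fun x y => by
      rw [dist_eq_norm, dist_eq_norm, ← map_sub, NNReal.coe_one, one_mul]
      exact NonUnitalStarAlgHom.norm_apply_le π _).uniformContinuous
  refine NonUnitalStarSubalgebra.topologicalClosure_minimal _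
    (NonUnitalStarAlgebra.adjoin_le ?_) ?_
  · rintro _ ⟨x, hx, rfl⟩
    exact ⟨x, NonUnitalStarSubalgebra.le_topologicalClosure _
      (NonUnitalStarAlgebra.subset_adjoin ℂ _ hx), rfl⟩
  · have : CompleteSpace D := hDc.completeSpace_coe
    have hanti : AntilipschitzWith 1 fun x : D => π x := by
      refine AntilipschitzWith.of_le_mul_dist fun x y => ?_
      rw [NNReal.coe_one, one_mul, dist_eq_norm, dist_eq_norm, ← map_sub]
      exact h _ (sub_mem x.2 y.2)
    have := hanti.isClosed_range (hπ.comp uniformContinuous_subtype_val)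
    convert this using 1
    ext y
    simp

/-- A closed subalgebra of `A × B` that is the graph of a function is the graph of a star
homomorphism. -/
theorem exists_hom_of_graph {S : NonUnitalStarSubalgebra ℂ A} {T : NonUnitalStarSubalgebra ℂ B}
    (D : NonUnitalStarSubalgebra ℂ (A × B)) (hS : ∀ a ∈ S, ∃ b ∈ T, (a, b) ∈ D)
    (hD : ∀ x ∈ D, x.1 = 0 → x.2 = 0) :
    ∃ φ : S →⋆ₙₐ[ℂ] T, ∀ a : S, ((a : A), (φ a : B)) ∈ D := by
  have huniq : ∀ a b b', (a, b) ∈ D → (a, b') ∈ D → b = b' := by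
    intro a b b' h h'
    have := hD _ (sub_mem h h')
    exact sub_eq_zero.1 (this (sub_self a))
  have hS' : ∀ a : S, ∃ b : T, ((a : A), (b : B)) ∈ D := fun a => by
    obtain ⟨b, hb, h⟩ := hS a a.2
    exact ⟨⟨b, hb⟩, h⟩
  choose f hf using hS'
  refine ⟨⟨⟨⟨⟨f, ?_⟩, ?_, ?_⟩, ?_⟩, ?_⟩, hf⟩
  · exact fun c a => Subtype.ext (huniq _ _ _ (hf _) (SMulMemClass.smul_mem c (hf a)))
  · exact Subtype.ext (huniq _ _ _ (hf _) (zero_mem D))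
  · exact fun a b => Subtype.ext (huniq _ _ _ (hf _) (add_mem (hf a) (hf b)))
  · exact fun a b => Subtype.ext (huniq _ _ _ (hf _) (mul_mem (hf a) (hf b)))
  · exact fun a => Subtype.ext (huniq _ _ _ (hf _) (star_mem (hf a)))

/-- The homomorphism has as its graph the closed algebra `D` generated by the pairs `(u s, v s)`: on
`D` the second coordinate is dominated by the first, hence determined by it. -/
theorem exists_hom_of_norm_le {I : Type*} [Mul I] [Inv I] (u : I → A) (v : I → B)
    (humul : ∀ s t, u (s * t) = u s * u t) (hvmul : ∀ s t, v (s * t) = v s * v t)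
    (huinv : ∀ s, u s⁻¹ = star (u s)) (hvinv : ∀ s, v s⁻¹ = star (v s))
    (hvu : ∀ (T : Finset I) (c : I → ℂ), ‖∑ s ∈ T, c s • v s‖ ≤ ‖∑ s ∈ T, c s • u s‖)
    {S : NonUnitalStarSubalgebra ℂ A} {T : NonUnitalStarSubalgebra ℂ B}
    (hS : S = (NonUnitalStarAlgebra.adjoin ℂ (Set.range u)).topologicalClosure)
    (hT : T = (NonUnitalStarAlgebra.adjoin ℂ (Set.range v)).topologicalClosure) :
    ∃ φ : S →⋆ₙₐ[ℂ] T, (∀ s (h : u s ∈ S), (φ ⟨u s, h⟩ : B) = v s) ∧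
      ((∀ (T : Finset I) (c : I → ℂ), ‖∑ s ∈ T, c s • u s‖ ≤ ‖∑ s ∈ T, c s • v s‖) →
        Function.Bijective φ) := by
  let w : I → A × B := fun s => (u s, v s)
  let D := jointCStar u v
  let fst := NonUnitalStarAlgHom.fst ℂ A B
  let snd := NonUnitalStarAlgHom.snd ℂ A B
  have hmul : ∀ s t, w (s * t) = w s * w t := fun s t => Prod.ext (humul s t) (hvmul s t)
  have hinv : ∀ s, w s⁻¹ = star (w s) := fun s => Prod.ext (huinv s) (hvinv s)
  have hle : ∀ x ∈ D, ‖x.2‖ ≤ ‖x.1‖ := fun x hx =>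
    norm_map_le_of_mem_closure w hmul hinv snd fst hvu hx
  have hfst : fst '' Set.range w = Set.range u := by rw [← Set.range_comp]; rfl
  have hsnd : snd '' Set.range w = Set.range v := by rw [← Set.range_comp]; rfl
  have hD1 : D ≤ S.comap fst := by
    refine NonUnitalStarSubalgebra.topologicalClosure_minimal _
      (NonUnitalStarAlgebra.adjoin_le ?_) ?_
    · rintro _ ⟨s, rfl⟩
      exact hS ▸ NonUnitalStarSubalgebra.le_topologicalClosure _
        (NonUnitalStarAlgebra.subset_adjoin ℂ _ (Set.mem_range_self s))
    · exact IsClosed.preimage continuous_fst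
        (hS ▸ NonUnitalStarSubalgebra.isClosed_topologicalClosure _ : IsClosed (S : Set A))
  have hD2 : D ≤ T.comap snd := by
    refine NonUnitalStarSubalgebra.topologicalClosure_minimal _
      (NonUnitalStarAlgebra.adjoin_le ?_) ?_
    · rintro _ ⟨s, rfl⟩
      exact hT ▸ NonUnitalStarSubalgebra.le_topologicalClosure _
        (NonUnitalStarAlgebra.subset_adjoin ℂ _ (Set.mem_range_self s))
    · exact IsClosed.preimage continuous_snd
        (hT ▸ NonUnitalStarSubalgebra.isClosed_topologicalClosure _ : IsClosed (T : Set B))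
  have hex : ∀ a ∈ S, ∃ b ∈ T, (a, b) ∈ D := by
    intro a ha
    -- The norm of `A × B` is the maximum, so `hle` makes the first projection isometric on `D`; its
    -- image is closed and therefore exhausts `S`.
    have h1 := closure_adjoin_image_le_map fst (Set.range w) fun x hx =>
      max_le le_rfl (hle x hx)
    rw [hfst, ← hS] at h1
    obtain ⟨⟨a', b⟩, hx, rfl⟩ := h1 ha
    exact ⟨b, hD2 hx, hx⟩
  have huniq : ∀ a b b', (a, b) ∈ D → (a, b') ∈ D → b = b' := by
    intro a b b' h h'
    have := hle _ (sub_mem h h')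
    rw [Prod.fst_sub, sub_self, norm_zero] at this
    exact sub_eq_zero.1 (norm_le_zero_iff.1 this)
  obtain ⟨φ, hφ⟩ := exists_hom_of_graph D hex fun x hx h0 =>
    norm_le_zero_iff.1 ((hle x hx).trans (by rw [h0, norm_zero]))
  refine ⟨φ, fun s h => huniq _ _ _ (hφ ⟨u s, h⟩) (mem_jointCStar u v s), fun huv => ?_⟩
  have hge : ∀ x ∈ D, ‖x.1‖ ≤ ‖x.2‖ := fun x hx =>
    norm_map_le_of_mem_closure w hmul hinv fst snd huv hx
  constructor
  · rw [injective_iff_map_eq_zero]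
    intro a ha
    have := hge _ (hφ a)
    rw [ha] at this
    exact Subtype.ext (norm_le_zero_iff.1 (this.trans norm_zero.le))
  · intro b
    have h1 := closure_adjoin_image_le_map snd (Set.range w) fun x hx =>
      max_le (hge x hx) le_rfl
    rw [hsnd, ← hT] at h1
    obtain ⟨⟨a, b'⟩, hx, hb⟩ := h1 b.2
    have hb' : b' = b := hb
    refine ⟨⟨a, hD1 hx⟩, Subtype.ext ?_⟩
    rw [← hb']
    exact huniq a _ _ (hφ ⟨a, _⟩) hx

theorem hom_ext_of_generators (s : Set A) {S : NonUnitalStarSubalgebra ℂ A}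
    (hS : S = (NonUnitalStarAlgebra.adjoin ℂ s).topologicalClosure) (ψ φ : S →⋆ₙₐ[ℂ] B)
    (h : ∀ a : S, (a : A) ∈ s → ψ a = φ a) : ψ = φ := by
  have hSc : IsClosed (S : Set A) :=
    hS ▸ NonUnitalStarSubalgebra.isClosed_topologicalClosure _
  have hψ : Continuous ψ := by
    open scoped CStarAlgebra in exact ContinuousMapClass.map_continuous ψ
  have hφ : Continuous φ := by
    open scoped CStarAlgebra in exact ContinuousMapClass.map_continuous φ
  let E : NonUnitalStarSubalgebra ℂ S := NonUnitalStarAlgHom.equalizer ψ φ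
  have hE : ∀ a, a ∈ E ↔ ψ a = φ a := fun a => Iff.rfl
  have hEc : IsClosed (E : Set S) := isClosed_eq hψ hφ
  have hle : S ≤ E.map (NonUnitalStarSubalgebraClass.subtype S) := by
    refine hS.trans_le <| NonUnitalStarSubalgebra.topologicalClosure_minimal _
      (NonUnitalStarAlgebra.adjoin_le fun a ha => ?_)
      (hSc.isClosedEmbedding_subtypeVal.isClosedMap _ hEc)
    exact ⟨⟨a, hS ▸ NonUnitalStarSubalgebra.le_topologicalClosure _
      (NonUnitalStarAlgebra.subset_adjoin ℂ _ ha)⟩, h _ ha, rfl⟩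
  ext a
  obtain ⟨a', ha', h'⟩ := hle a.2
  obtain rfl : a' = a := Subtype.ext h'
  rw [(hE _).1 ha']

end Graph

/-! ### The left inverse hull, its two representations, and necessity of independence -/

namespace LeftInverseHull

section Semigroup

variable {P : Type*} [Semigroup P] [IsLeftCancelMul P]

theorem mul_val_apply (s t : LeftInverseHull P) (x : P) : (s * t).1 x = (t.1 x).bind s.1 := rfl

theorem mem_dom {s : LeftInverseHull P} {x : P} : x ∈ dom s ↔ ∃ y, s.1 x = some y := by
  simp [dom, Option.isSome_iff_exists]

theorem notMem_dom {s : LeftInverseHull P} {x : P} : x ∉ dom s ↔ s.1 x = none := by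
  simp [dom]

theorem dom_mul_subset (s t : LeftInverseHull P) : dom (s * t) ⊆ dom t := by
  intro x hx
  obtain ⟨y, hy⟩ := mem_dom.1 hx
  rw [mul_val_apply, Option.bind_eq_some_iff] at hy
  obtain ⟨z, hz, -⟩ := hy
  exact mem_dom.2 ⟨z, hz⟩

theorem inv_mul_self_apply (s : LeftInverseHull P) (x y : P) :
    (s⁻¹ * s).1 x = some y ↔ x = y ∧ x ∈ dom s := by
  rw [mul_val_apply, Option.bind_eq_some_iff, mem_dom]
  constructor
  · rintro ⟨z, hz, h⟩
    have hy : s.1 y = some z := (PEquiv.eq_some_iff s.1).1 h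
    exact ⟨PEquiv.inj s.1 hz hy, z, hz⟩
  · rintro ⟨rfl, z, hz⟩
    exact ⟨z, hz, (PEquiv.eq_some_iff s.1).2 hz⟩

theorem dom_inv_mul_self (s : LeftInverseHull P) : dom (s⁻¹ * s) = dom s := by
  ext x
  rw [mem_dom]
  simp [inv_mul_self_apply]

/-- Right multiplication by an idempotent restricts the domain, so constructible ideals are closed
under intersection. -/
theorem mem_dom_mul_inv_mul_self (t s : LeftInverseHull P) (x : P) :
    x ∈ dom (t * (s⁻¹ * s)) ↔ x ∈ dom s ∧ x ∈ dom t := by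
  rw [mem_dom, mem_dom (s := t)]
  simp only [mul_val_apply t, Option.bind_eq_some_iff, inv_mul_self_apply]
  constructor
  · rintro ⟨y, z, ⟨rfl, h⟩, hy⟩
    exact ⟨h, y, hy⟩
  · rintro ⟨h, y, hy⟩
    exact ⟨y, x, ⟨rfl, h⟩, hy⟩

theorem ne_bot_of_mem_dom {s : LeftInverseHull P} {x : P} (hx : x ∈ dom s) : s.1 ≠ ⊥ := by
  intro h
  obtain ⟨y, hy⟩ := mem_dom.1 hx
  rw [h] at hy
  cases hy

theorem dom_nonempty_of_ne_bot {s : LeftInverseHull P} (hs : s.1 ≠ ⊥) : (dom s).Nonempty := by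
  by_contra h
  refine hs (PEquiv.ext fun x => ?_)
  exact notMem_dom.1 fun hx => h ⟨x, hx⟩

/-- The working form of the order relation: `λ_s` kills `δ_x` exactly when composing with `s`
shrinks the domain of `x`. -/
theorem rangeLEDom_iff_dom_mul (s x : LeftInverseHull P) :
    RangeLEDom s x ↔ dom (s * x) = dom x := by
  rw [rangeLEDom_iff]
  constructor
  · intro h
    refine (dom_mul_subset s x).antisymm ?_
    conv_lhs => rw [← h]
    exact dom_mul_subset _ _
  · intro h
    apply Subtype.ext
    refine PEquiv.ext fun p => ?_
    rw [← mul_assoc, mul_val_apply]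
    rcases hp : x.1 p with _ | q
    · rfl
    · have : p ∈ dom (s * x) := h ▸ mem_dom.2 ⟨q, hp⟩
      obtain ⟨r, hr⟩ := mem_dom.1 this
      rw [mul_val_apply, hp] at hr
      exact (inv_mul_self_apply s q q).2 ⟨rfl, mem_dom.2 ⟨r, hr⟩⟩

open Classical in
theorem act_eq_some {s : LeftInverseHull P} {x y : Nonzero P} :
    act s x = some y ↔ RangeLEDom s x.1 ∧ y.1 = s * x.1 := by
  change (if h : RangeLEDom s x.1 then some ⟨s * x.1, mul_ne_bot x.2 h⟩ else none) = some y ↔ _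
  split_ifs with h
  · exact ⟨fun e => ⟨h, (congrArg Subtype.val (Option.some.inj e)).symm⟩,
      fun e => congrArg some (Subtype.ext e.2.symm)⟩
  · simp [h]

theorem act_eq_none {s : LeftInverseHull P} {x : Nonzero P} :
    act s x = none ↔ ¬ RangeLEDom s x.1 := by
  rw [Option.eq_none_iff_forall_ne_some]
  constructor
  · intro h hs
    exact h ⟨s * x.1, mul_ne_bot x.2 hs⟩ (act_eq_some.2 ⟨hs, rfl⟩)
  · intro h y hy
    exact h (act_eq_some.1 hy).1

theorem rangeLEDom_mul (s t x : LeftInverseHull P) :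
    RangeLEDom (s * t) x ↔ RangeLEDom t x ∧ RangeLEDom s (t * x) := by
  simp only [rangeLEDom_iff_dom_mul, mul_assoc]
  constructor
  · intro h
    have h1 : dom (t * x) = dom x :=
      (dom_mul_subset _ _).antisymm (h ▸ dom_mul_subset s (t * x))
    exact ⟨h1, h.trans h1.symm⟩
  · rintro ⟨h1, h2⟩
    exact h2.trans h1

theorem act_mul (s t : LeftInverseHull P) : act (s * t) = (act t).trans (act s) := by
  refine PEquiv.ext fun x => Option.ext fun y => ?_
  rw [PEquiv.trans_eq_some, act_eq_some, rangeLEDom_mul]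
  constructor
  · rintro ⟨⟨h1, h2⟩, h3⟩
    exact ⟨⟨t * x.1, mul_ne_bot x.2 h1⟩, act_eq_some.2 ⟨h1, rfl⟩,
      act_eq_some.2 ⟨h2, h3.trans (mul_assoc _ _ _)⟩⟩
  · rintro ⟨z, hz, hy⟩
    obtain ⟨h1, h2⟩ := act_eq_some.1 hz
    obtain ⟨h3, h4⟩ := act_eq_some.1 hy
    rw [h2] at h3 h4
    exact ⟨⟨h1, h3⟩, h4.trans (mul_assoc _ _ _).symm⟩

theorem act_inv (s : LeftInverseHull P) : act s⁻¹ = (act s).symm := rfl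

theorem lambda_mul (s t : LeftInverseHull P) : lambda (s * t) = lambda s * lambda t := by
  rw [lambda, act_mul, partialIsometry_trans]; rfl

theorem lambda_inv (s : LeftInverseHull P) : lambda s⁻¹ = star (lambda s) := by
  rw [lambda, act_inv, ← star_partialIsometry]; rfl

/-- The partial isometry on `ℓ² P` given by an element of the left inverse hull. -/
def opV (s : LeftInverseHull P) : EllTwo P →L[ℂ] EllTwo P := partialIsometry s.1

theorem opV_mul (s t : LeftInverseHull P) : opV (s * t) = opV s * opV t :=
  partialIsometry_trans s.1 t.1

theorem opV_inv (s : LeftInverseHull P) : opV s⁻¹ = star (opV s) :=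
  (star_partialIsometry s.1).symm

@[elab_as_elim]
theorem hull_induction {C : LeftInverseHull P → Prop} (ofElem : ∀ p, C (ofElem p))
    (inv : ∀ s, C s → C s⁻¹) (mul : ∀ s t, C s → C t → C (s * t)) (s : LeftInverseHull P) :
    C s := by
  obtain ⟨s, hs⟩ := s
  induction hs with
  | leftMul p => exact ofElem p
  | symm s hs h => exact inv ⟨s, hs⟩ h
  | comp s t hs ht h h' => exact mul ⟨s, hs⟩ ⟨t, ht⟩ h h'

theorem opV_mem (s : LeftInverseHull P) : opV s ∈ reducedSemigroupCStar P := by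
  induction s using hull_induction with
  | ofElem p => exact subset_generatedCStar _ (Set.mem_range_self p)
  | inv s h => rw [opV_inv]; exact star_mem h
  | mul s t hs ht => rw [opV_mul]; exact mul_mem hs ht

theorem lambda_mem (s : LeftInverseHull P) : lambda s ∈ reducedHullCStar P :=
  subset_generatedCStar _ (Set.mem_range_self s)

/-- The hull is generated by `P` under products and inverses, and both representations respect these
operations. -/
theorem hom_lambda (ψ : reducedHullCStar P →⋆ₙₐ[ℂ] reducedSemigroupCStar P)
    (hψ : ∀ p : P, ψ (genLambda p) = genV p) (s : LeftInverseHull P) :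
    ψ ⟨lambda s, lambda_mem s⟩ = ⟨opV s, opV_mem s⟩ := by
  induction s using hull_induction with
  | ofElem p => exact hψ p
  | inv s h =>
    have h1 : (⟨lambda s⁻¹, lambda_mem s⁻¹⟩ : reducedHullCStar P)
      = star ⟨lambda s, lambda_mem s⟩ := Subtype.ext (lambda_inv s)
    rw [h1, map_star, h]
    exact Subtype.ext (opV_inv s).symm
  | mul s t hs ht =>
    have h1 : (⟨lambda (s * t), lambda_mem (s * t)⟩ : reducedHullCStar P)
      = ⟨lambda s, lambda_mem s⟩ * ⟨lambda t, lambda_mem t⟩ := Subtype.ext (lambda_mul s t)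
    rw [h1, map_mul, hs, ht]
    exact Subtype.ext (opV_mul s t).symm

theorem hom_unique (ψ φ : reducedHullCStar P →⋆ₙₐ[ℂ] reducedSemigroupCStar P)
    (hψ : ∀ p : P, ψ (genLambda p) = genV p) (hφ : ∀ p : P, φ (genLambda p) = genV p) :
    ψ = φ := by
  have : IsClosed (reducedSemigroupCStar P : Set (EllTwo P →L[ℂ] EllTwo P)) :=
    NonUnitalStarSubalgebra.isClosed_topologicalClosure _
  refine hom_ext_of_generators _ rfl ψ φ ?_
  rintro a ⟨s, hs⟩
  obtain rfl : a = ⟨lambda s, lambda_mem s⟩ := Subtype.ext hs.symm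
  exact (hom_lambda ψ hψ s).trans (hom_lambda φ hφ s).symm

/-- A constructible ideal around a point that is contained in all those domains from a given
finite family which contain the point. -/
theorem exists_dom_subset (F : Finset (LeftInverseHull P)) (p : P) :
    ∃ u : LeftInverseHull P, p ∈ dom u ∧ ∀ s ∈ F, p ∈ dom s → dom u ⊆ dom s := by
  classical
  induction F using Finset.induction_on with
  | empty => exact ⟨ofElem p, mem_dom.2 ⟨p * p, rfl⟩, by simp⟩
  | insert s F _ ih =>
    obtain ⟨u, hu, hF⟩ := ih
    by_cases hs : p ∈ dom s
    · refine ⟨u * (s⁻¹ * s), (mem_dom_mul_inv_mul_self u s p).2 ⟨hs, hu⟩, fun t ht htp x hx => ?_⟩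
      obtain ⟨h1, h2⟩ := (mem_dom_mul_inv_mul_self u s x).1 hx
      rcases Finset.mem_insert.1 ht with rfl | ht
      · exact h1
      · exact hF t ht htp h2
    · refine ⟨u, hu, fun t ht htp => ?_⟩
      rcases Finset.mem_insert.1 ht with rfl | ht
      · exact absurd htp hs
      · exact hF t ht htp

/-- Otherwise the proper constructible subideals coming from `F` would cover `dom e`, against
independence. -/
theorem _root_.SemigroupCStar.Independence.exists_mem_forall_notMem (h : Independence P)
    (e : LeftInverseHull P) (he : (dom e).Nonempty) (F : Finset (LeftInverseHull P)) :
    ∃ p ∈ dom e, ∀ s ∈ F, dom s ⊆ dom e → dom s ≠ dom e → p ∉ dom s := by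
  classical
  by_contra! hcon
  let F' := F.filter fun s => dom s ⊆ dom e ∧ dom s ≠ dom e
  have hcov : ∀ p ∈ dom e, ∃ s ∈ F', p ∈ dom s := fun p hp => by
    obtain ⟨s, hs, h1, h2, h3⟩ := hcon p hp
    exact ⟨s, Finset.mem_filter.2 ⟨hs, h1, h2⟩, h3⟩
  -- Independence concerns covers by at least one ideal; a point of `dom e` shows that the cover is
  -- nonempty.
  obtain ⟨p, hp⟩ := he
  obtain ⟨s₀, hs₀, -⟩ := hcov p hp
  obtain ⟨n, hn⟩ := Nat.exists_eq_succ_of_ne_zero (Finset.card_ne_zero_of_mem hs₀)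
  let E := F'.equivFinOfCardEq hn
  obtain ⟨i, hi⟩ := h (dom e) ⟨e, rfl⟩ n (fun i => dom (E.symm i).1) (fun i => ⟨_, rfl⟩) (by
    ext q
    rw [Set.mem_iUnion]
    constructor
    · intro hq
      obtain ⟨s, hs, hqs⟩ := hcov q hq
      exact ⟨E ⟨s, hs⟩, by simpa using hqs⟩
    · rintro ⟨i, hi⟩
      exact (Finset.mem_filter.1 (E.symm i).2).2.1 hi)
  exact (Finset.mem_filter.1 (E.symm i).2).2.2 hi.symm

theorem independence_of_injective (φ : reducedHullCStar P →⋆ₙₐ[ℂ] reducedSemigroupCStar P)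
    (hφ : ∀ p : P, φ (genLambda p) = genV p) (hinj : Function.Injective φ) : Independence P := by
  classical
  rintro _ ⟨s, rfl⟩ n Y hY hX
  by_contra! hne
  choose t ht using hY
  have hsub : ∀ i, Y i ⊆ dom s := fun i => hX ▸ Set.subset_iUnion Y i
  have he : (s⁻¹ * s).1 ≠ ⊥ := by
    -- Were `dom s` empty, every `Y i` would be empty too and hence equal to it.
    obtain ⟨p, hp⟩ : (dom s).Nonempty := by
      rw [Set.nonempty_iff_ne_empty]
      intro h0
      refine hne 0 ?_
      rw [h0]
      exact (Set.subset_empty_iff.1 (h0 ▸ hsub 0)).symm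
    exact ne_bot_of_mem_dom (x := p) (by rwa [dom_inv_mul_self])
  let e : Nonzero P := ⟨s⁻¹ * s, he⟩
  -- The element is `λ_e ∏_{i ∈ F} (1 - λ_{f_i})`, built one factor at a time inside the possibly
  -- nonunital algebra.
  have hind : ∀ F : Finset (Fin (n + 1)), ∃ a : reducedHullCStar P,
      a.1 (delta e) = delta e ∧
        ∀ p, (p ∉ dom s ∨ ∃ i ∈ F, p ∈ Y i) → (φ a).1 (delta p) = 0 := by
    intro F
    induction F using Finset.induction_on with
    | empty =>
      refine ⟨⟨lambda (s⁻¹ * s), lambda_mem _⟩, ?_, ?_⟩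
      · have : act (s⁻¹ * s) e = some e := by
          have h0 : s⁻¹ * s * (s⁻¹ * s) = s⁻¹ * s := by
            rw [mul_assoc, ← mul_assoc s, mul_inv_mul]
          exact act_eq_some.2 ⟨(rangeLEDom_iff_dom_mul _ _).2 (by rw [h0]), h0.symm⟩
        simp only [lambda, partialIsometry_delta, this, Option.elim_some]
      · rintro p (hp | ⟨i, hi, -⟩)
        · rw [← dom_inv_mul_self, notMem_dom] at hp
          rw [hom_lambda φ hφ]
          simp only [opV, partialIsometry_delta, hp, Option.elim_none]
        · simp at hi
    | insert i F _ ih =>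
      obtain ⟨a, ha, hF⟩ := ih
      let f : LeftInverseHull P := (t i)⁻¹ * t i
      refine ⟨a - a * ⟨lambda f, lambda_mem f⟩, ?_, ?_⟩
      · have : act f e = none := by
          rw [act_eq_none, rangeLEDom_iff_dom_mul]
          intro h
          apply hne i
          have h1 : dom (f * (s⁻¹ * s)) = dom (s⁻¹ * s) := h
          rw [dom_inv_mul_self] at h1
          rw [← ht i, ← dom_inv_mul_self (t i)]
          refine Set.Subset.antisymm (fun x hx => ?_) ?_
          · rw [← h1] at hx
            exact ((mem_dom_mul_inv_mul_self f s x).1 hx).2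
          · rw [dom_inv_mul_self, ht i]
            exact hsub i
        change a.1 (delta e) - a.1 (lambda f (delta e)) = _
        rw [lambda, partialIsometry_delta, this]
        simp [ha]
      · intro p hp
        rw [map_sub, map_mul, hom_lambda φ hφ]
        change (φ a).1 (delta p) - (φ a).1 (opV f (delta p)) = 0
        rw [opV, partialIsometry_delta]
        by_cases hpi : p ∈ Y i
        · have : f.1 p = some p := (inv_mul_self_apply _ _ _).2 ⟨rfl, ht i ▸ hpi⟩
          rw [this]
          simp
        · have h1 : f.1 p = none := by
            rw [← notMem_dom, dom_inv_mul_self, ht i]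
            exact hpi
          rw [h1, Option.elim_none, map_zero, sub_zero]
          apply hF
          rcases hp with hp | ⟨j, hj, hpj⟩
          · exact .inl hp
          · rcases Finset.mem_insert.1 hj with rfl | hj
            · exact absurd hpj hpi
            · exact .inr ⟨j, hj, hpj⟩
  obtain ⟨a, ha, hF⟩ := hind Finset.univ
  have h0 : φ a = 0 := by
    apply Subtype.ext
    refine clm_ext_delta fun p => ?_
    rw [hF p]
    · simp
    · by_cases hp : p ∈ dom s
      · rw [hX, Set.mem_iUnion] at hp
        obtain ⟨i, hi⟩ := hp
        exact .inr ⟨i, Finset.mem_univ i, hi⟩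
      · exact .inl hp
  have ha0 : a = 0 := hinj (h0.trans (map_zero φ).symm)
  rw [ha0] at ha
  exact delta_ne_zero e ha.symm

end Semigroup

/-! ### Subsemigroups of groups: the two norm inequalities and the conclusion -/

section Group

variable {G : Type*} [Group G] {P : Subsemigroup G}

/-- Elements of the left inverse hull act by left multiplication by group elements. -/
theorem exists_eq_mul (s : LeftInverseHull P) :
    ∃ g : G, ∀ x y : P, s.1 x = some y → (y : G) = g * x := by
  induction s using hull_induction with
  | ofElem p =>
    refine ⟨p, fun x y h => ?_⟩
    have : p * x = y := Option.some.inj h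
    rw [← this]; rfl
  | inv s h =>
    obtain ⟨g, hg⟩ := h
    refine ⟨g⁻¹, fun x y h => ?_⟩
    rw [hg y x ((PEquiv.eq_some_iff s.1).1 h), inv_mul_cancel_left]
  | mul s t hs ht =>
    obtain ⟨g, hg⟩ := hs
    obtain ⟨k, hk⟩ := ht
    refine ⟨g * k, fun x y h => ?_⟩
    rw [mul_val_apply, Option.bind_eq_some_iff] at h
    obtain ⟨z, hz, hy⟩ := h
    rw [hg z y hy, hk x z hz, mul_assoc]

/-- One common value forces the two translating group elements to coincide, by cancellation in `G`.
-/
theorem ext_of_dom_eq {s t : LeftInverseHull P} (h : dom s = dom t) {x y : P}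
    (hs : s.1 x = some y) (ht : t.1 x = some y) : s = t := by
  obtain ⟨g, hg⟩ := exists_eq_mul s
  obtain ⟨k, hk⟩ := exists_eq_mul t
  have hgk : g = k := mul_right_cancel ((hg x y hs).symm.trans (hk x y ht))
  apply Subtype.ext
  refine PEquiv.ext fun z => ?_
  by_cases hz : z ∈ dom s
  · obtain ⟨a, ha⟩ := mem_dom.1 hz
    obtain ⟨b, hb⟩ := mem_dom.1 (h ▸ hz)
    rw [ha, hb]
    exact congrArg some (Subtype.ext (by rw [hg z a ha, hk z b hb, hgk]))
  · rw [notMem_dom.1 hz, notMem_dom.1 (h ▸ hz)]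

/-- Points are labelled by their orbit under the hull; a finite piece of an orbit embeds in
`I_l(P)^×` as elements with one common small domain. -/
theorem norm_sum_opV_le (T : Finset (LeftInverseHull P)) (c : LeftInverseHull P → ℂ) :
    ‖∑ s ∈ T, c s • opV s‖ ≤ ‖∑ s ∈ T, c s • lambda s‖ := by
  classical
  refine norm_sum_partialIsometry_le (fun s : LeftInverseHull P => s.1) act
    (fun x => {y | ∃ s : LeftInverseHull P, s.1 x = some y}) ?_ ?_ T c
  · intro s x y h
    ext z
    constructor
    · rintro ⟨t, ht⟩
      exact ⟨t * s, by rw [mul_val_apply, h]; exact ht⟩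
    · rintro ⟨t, ht⟩
      refine ⟨t * s⁻¹, ?_⟩
      have : s⁻¹.1 y = some x := (PEquiv.eq_some_iff s.1).2 h
      rw [mul_val_apply, this]
      exact ht
  · rintro T S ⟨p, hp⟩ horb
    have hex : ∀ x, ∃ t : LeftInverseHull P, x ∈ S → t.1 p = some x := by
      intro x
      by_cases hx : x ∈ S
      · have hxx : x ∈ {y | ∃ s : LeftInverseHull P, s.1 x = some y} :=
          ⟨(ofElem x)⁻¹ * ofElem x, (inv_mul_self_apply _ _ _).2 ⟨rfl, mem_dom.2 ⟨x * x, rfl⟩⟩⟩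
        rw [horb x hx p hp] at hxx
        obtain ⟨t, ht⟩ := hxx
        exact ⟨t, fun _ => ht⟩
      · exact ⟨ofElem x, fun h => absurd h hx⟩
    choose t ht using hex
    -- `dom u` lies in every `dom (t x)` and in those `dom (s * t x)` that contain `p`, so
    -- restricting to it makes all relevant domains equal to `dom u`.
    obtain ⟨u, hu, hF⟩ := exists_dom_subset
      (S.image t ∪ Finset.image₂ (fun s x => s * t x) T S) p
    have hup : (u⁻¹ * u).1 p = some p := (inv_mul_self_apply _ _ _).2 ⟨rfl, hu⟩
    have hval : ∀ x ∈ S, (t x * (u⁻¹ * u)).1 p = some x := by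
      intro x hx
      rw [mul_val_apply, hup]
      exact ht x hx
    have hdom : ∀ v : LeftInverseHull P, dom u ⊆ dom v → dom (v * (u⁻¹ * u)) = dom u := by
      intro v hv
      ext x
      rw [mem_dom_mul_inv_mul_self]
      exact ⟨fun h => h.1, fun h => ⟨h, hv h⟩⟩
    have hdomt : ∀ x ∈ S, dom (t x * (u⁻¹ * u)) = dom u := fun x hx =>
      hdom _ (hF _ (Finset.mem_union_left _ (Finset.mem_image_of_mem _ hx))
        (mem_dom.2 ⟨x, ht x hx⟩))
    have hθ : ∀ x, ∃ y : Nonzero P, x ∈ S → y.1 = t x * (u⁻¹ * u) := by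
      intro x
      by_cases hx : x ∈ S
      · exact ⟨⟨_, ne_bot_of_mem_dom (mem_dom.2 ⟨x, hval x hx⟩)⟩, fun _ => rfl⟩
      -- An arbitrary nonzero value; only the points of `S` matter.
      · exact ⟨⟨ofElem x, ne_bot_of_mem_dom (x := x) (mem_dom.2 ⟨x * x, rfl⟩)⟩,
          fun h => absurd h hx⟩
    choose θ hθ using hθ
    refine ⟨θ, ?_, ?_⟩
    · intro x hx y hy hxy
      have h1 := hval x hx
      rw [← hθ x hx, hxy, hθ y hy, hval y hy] at h1
      exact (Option.some.inj h1).symm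
    · intro s hs x hx
      refine ⟨fun y hy hxy => ?_, fun hxn => ?_⟩
      · have hst : (s * t x).1 p = some y := by
          rw [mul_val_apply, ht x hx]
          exact hxy
        have hd : dom (s * (t x * (u⁻¹ * u))) = dom u := by
          rw [← mul_assoc]
          exact hdom _ (hF _ (Finset.mem_union_right _ (Finset.mem_image₂_of_mem hs hx))
            (mem_dom.2 ⟨y, hst⟩))
        refine act_eq_some.2 ⟨?_, ?_⟩
        · rw [hθ x hx, rangeLEDom_iff_dom_mul, hd, hdomt x hx]
        · rw [hθ x hx, hθ y hy]
          refine ext_of_dom_eq (x := p) (y := y) ((hdomt y hy).trans hd.symm) (hval y hy) ?_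
          rw [mul_val_apply, hval x hx]
          exact hxy
      -- If `s` is undefined at `x`, the composite is undefined at `p`, so its domain has shrunk.
      · rw [act_eq_none, hθ x hx, rangeLEDom_iff_dom_mul]
        intro h
        have h1 : p ∈ dom (s * (t x * (u⁻¹ * u))) := h ▸ mem_dom.2 ⟨x, hval x hx⟩
        refine notMem_dom.2 ?_ h1
        rw [mul_val_apply, hval x hx]
        exact hxn

/-- Elements are labelled by their domain, which `act` preserves; evaluation at a generic point of
the common domain is the embedding. -/
theorem norm_sum_lambda_le (hP : Independence P) (T : Finset (LeftInverseHull P))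
    (c : LeftInverseHull P → ℂ) :
    ‖∑ s ∈ T, c s • lambda s‖ ≤ ‖∑ s ∈ T, c s • opV s‖ := by
  classical
  refine norm_sum_partialIsometry_le act (fun s : LeftInverseHull P => s.1)
    (fun x : Nonzero P => dom x.1) ?_ ?_ T c
  · intro s x y h
    obtain ⟨h1, h2⟩ := act_eq_some.1 h
    rw [h2]
    exact (rangeLEDom_iff_dom_mul _ _).1 h1
  · rintro T S ⟨e, he⟩ hS
    -- The point `p` avoids each `dom (s * x)` smaller than the common domain, so `s` is undefined
    -- at `x p` whenever `λ_s` kills `δ_x`.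
    obtain ⟨p, hp, hF⟩ := hP.exists_mem_forall_notMem e.1 (dom_nonempty_of_ne_bot e.2)
      (Finset.image₂ (fun s (x : Nonzero P) => s * x.1) T S)
    have hval : ∀ x ∈ S, x.1.1 p = some ((x.1.1 p).getD p) := by
      intro x hx
      have hpx : p ∈ dom x.1 := by
        have : dom x.1 = dom e.1 := hS x hx e he
        rwa [this]
      obtain ⟨y, hy⟩ := mem_dom.1 hpx
      simp [hy]
    -- On `S` every element is defined at `p`, so the default of `getD` is never taken there.
    refine ⟨fun x => (x.1.1 p).getD p, ?_, ?_⟩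
    · intro x hx y hy hxy
      refine Subtype.ext (ext_of_dom_eq (hS x hx y hy) (hval x hx) ?_)
      rw [hval y hy]
      exact congrArg some hxy.symm
    · intro s hs x hx
      have hsx : (s * x.1).1 p = s.1 ((x.1.1 p).getD p) := by
        rw [mul_val_apply, hval x hx]; rfl
      refine ⟨fun y hy hxy => ?_, fun hxn => ?_⟩
      · rw [← hsx, ← (act_eq_some.1 hxy).2]
        exact hval y hy
      · rw [act_eq_none, rangeLEDom_iff_dom_mul] at hxn
        have hxe : dom x.1 = dom e.1 := hS x hx e he
        have h1 := hF (s * x.1) (Finset.mem_image₂_of_mem hs hx)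
          (hxe ▸ dom_mul_subset s x.1) (hxe ▸ hxn)
        rw [notMem_dom, hsx] at h1
        exact h1

/-- Adding all `opV s` to the generators `V_p` changes nothing, and gives both algebras the same
index set `I_l(P)`. -/
theorem closure_range_opV (P : Subsemigroup G) :
    reducedSemigroupCStar P = generatedCStar (Set.range (opV (P := P))) := by
  refine le_antisymm ?_ ?_
  · refine NonUnitalStarSubalgebra.topologicalClosure_mono (NonUnitalStarAlgebra.adjoin_mono ?_)
    rintro _ ⟨p, rfl⟩
    exact ⟨ofElem p, rfl⟩
  · refine NonUnitalStarSubalgebra.topologicalClosure_minimal _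
      (NonUnitalStarAlgebra.adjoin_le ?_) (NonUnitalStarSubalgebra.isClosed_topologicalClosure _)
    rintro _ ⟨s, rfl⟩
    exact opV_mem s

theorem exists_hom_bijective_iff (P : Subsemigroup G) :
    ∃ φ : reducedHullCStar P →⋆ₙₐ[ℂ] reducedSemigroupCStar P,
      (∀ p : P, φ (genLambda p) = genV p) ∧ (Function.Bijective φ ↔ Independence P) := by
  obtain ⟨φ, hφ, hbij⟩ := exists_hom_of_norm_le (S := reducedHullCStar P)
    (T := reducedSemigroupCStar P) lambda opV lambda_mul opV_mul lambda_inv opV_inv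
    norm_sum_opV_le rfl (closure_range_opV P)
  have hgen : ∀ p : P, φ (genLambda p) = genV p := fun p =>
    Subtype.ext (hφ (ofElem p) (lambda_mem _))
  exact ⟨φ, hgen, fun h => independence_of_injective φ hgen h.1,
    fun hP => hbij (norm_sum_lambda_le hP)⟩

end Group

end LeftInverseHull

end SemigroupCStar

end

theorem mainTheorem4 {G : Type*} [Group G] (P : Subsemigroup G) :
    ∃ φ : SemigroupCStar.reducedHullCStar P →⋆ₙₐ[ℂ] SemigroupCStar.reducedSemigroupCStar P,
      (∀ p : P, φ (SemigroupCStar.genLambda p) = SemigroupCStar.genV p) ∧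
      (∀ ψ : SemigroupCStar.reducedHullCStar P →⋆ₙₐ[ℂ] SemigroupCStar.reducedSemigroupCStar P,
        (∀ p : P, ψ (SemigroupCStar.genLambda p) = SemigroupCStar.genV p) → ψ = φ) ∧
      (Function.Bijective φ ↔ SemigroupCStar.Independence P) := by
  refine (SemigroupCStar.LeftInverseHull.exists_hom_bijective_iff P).imp fun φ h => ⟨h.1, ?_, h.2⟩
  intro ψ hψ
  exact SemigroupCStar.LeftInverseHull.hom_unique ψ φ hψ h.1
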